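/- Let $M$ be a (Hausdorff, $\sigma$-compact, finite-dimensional) smooth manifold. A *Courant algebroid* on $M$ is a smooth vector bundle $V\to M$ with a smooth non-degenerate symmetric pairing $\langle\,,\rangle$ on the fibres, a smooth bundle map $a:V\to TM$ (the anchor) and an $\mathbb R$-bilinear bracket $*$ on $\Gamma(V)$ such that for all $\mathfrak X,\mathfrak Y,\mathfrak Z\in\Gamma(V)$ $$\mathfrak X*(\mathfrak Y*\mathfrak Z)=(\mathfrak X*\mathfrak Y)*\mathfrak Z+\mathfrak Y*(\mathfrak X*\mathfrak Z),\qquad a(\mathfrak X)\langle\mathfrak Y,\mathfrak Z\rangle=\langle\mathfrak X,\mathfrak Y*\mathfrak Z+\mathfrak Z*\mathfrak Y\rangle=\langle\mathfrak X*\mathfrak Y,\mathfrak Z\rangle+\langle\mathfrak Y,\mathfrak X*\mathfrak Z\rangle .$$ It is an *extended tangent bundle* (exact Courant algebroid), written $\mathcal TM$, if $$0\to T^*M\xrightarrow{a^*}\mathcal TM\xrightarrow{a}TM\to0$$ is exact, where $a^*$ is defined by $2\langle a^*\xi,\mathfrak X\rangle=\xi(a(\mathfrak X))$. An *isotropic splitting*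 is a smooth bundle map $s:TM\to\mathcal TM$ with $a\circ s=\mathrm{id}$ and $\langle s(X),s(Y)\rangle=0$ for all $X,Y$. A *symmetry* of $\mathcal TM$ is a smooth vector bundle automorphism $\phi$ of $\mathcal TM$ covering a diffeomorphism $\lambda$ of $M$, which preserves $\langle\,,\rangle$, satisfies $a\circ\phi=\lambda_*\circ a$, and preserves $*$ (acting on sections by push-forward). An *action* of a Lie group $G$ on $\mathcal TM$ is a group homomorphism $g\mapsto\tilde\sigma_g$ from $G$ to the group of symmetries such that $G\times\mathcal TM\to\mathcal TM$, $(g,v)\mapsto\tilde\sigma_g(v)$, is smooth. Let $\lambda_g$ be the diffeomorphism covered by $\tilde\sigma_g$. The action *preserves* the isotropic splitting $s$ if, under the identification $TM\oplus T^*M\cong\mathcal TM$, $X+\xi\mapsto s(X)+a^*\xi$, every $\tilde\sigma_g$ is the map induced by $\lambda_g$ alone, i.e. $$\tilde\sigma_g\bigl(s(X)+a^*\xi\bigr)=s\bigl((\lambda_g)_*X\bigr)+a^*\bigl((\lambda_g^{-1})^*\xi\bigr)\qquad\text{for all }g\in G,\ x\in M,\ X\in T_xM,\ \xi\in T_x^*M.$$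 **Proposition.** Let $G$ be a compact Lie group and $\tilde\sigma$ an action of $G$ on an extended tangent bundle $\mathcal TM$. Then there exists an isotropic splitting $s$ of $\mathcal TM$ that is preserved by $\tilde\sigma$. -/

import Mathlib

open Bundle
open scoped Manifold ContDiff

noncomputable section

namespace CourantGeometry

section Structures

variable {E : Type*} [NormedAddCommGroup E] [NormedSpace ℝ E]
  {M : Type*} [TopologicalSpace M] [ChartedSpace E M] [IsManifold 𝓘(ℝ, E) ∞ M]
  {F : Type*} [NormedAddCommGroup F] [NormedSpace ℝ F]
  {V : M → Type*} [TopologicalSpace (TotalSpace F V)]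
  [∀ x, AddCommGroup (V x)] [∀ x, Module ℝ (V x)] [∀ x, TopologicalSpace (V x)]
  [∀ x, IsTopologicalAddGroup (V x)] [∀ x, ContinuousSMul ℝ (V x)]
  [FiberBundle F V] [VectorBundle ℝ F V]

variable (E F V) in
/-- A Courant algebroid structure on the smooth real vector bundle `V → M` (with model fibre `F`,
over a manifold modelled on `E`): a smooth non-degenerate symmetric pairing on the fibres, a smooth
anchor `a : V → TM`, and a Loday bracket on the smooth sections of `V`. -/
structure CourantAlgebroid where
  /-- The pairing `⟨ , ⟩` on the fibres. -/
  pairing : ∀ x : M, V x →L[ℝ] V x →L[ℝ] ℝ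
  pairing_smooth : ContMDiff 𝓘(ℝ, E) (𝓘(ℝ, E).prod 𝓘(ℝ, F →L[ℝ] F →L[ℝ] ℝ)) ∞
    (fun x : M => TotalSpace.mk' (F →L[ℝ] F →L[ℝ] ℝ)
      (E := fun x : M => V x →L[ℝ] V x →L[ℝ] ℝ) x (pairing x))
  pairing_symm : ∀ (x : M) (v w : V x), pairing x v w = pairing x w v
  pairing_nondegenerate : ∀ (x : M) (v : V x), (∀ w : V x, pairing x v w = 0) → v = 0
  /-- The anchor map `a : V → TM`. -/
  anchor : ∀ x : M, V x →L[ℝ] TangentSpace 𝓘(ℝ, E) x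
  anchor_smooth : ContMDiff 𝓘(ℝ, E) (𝓘(ℝ, E).prod 𝓘(ℝ, F →L[ℝ] E)) ∞
    (fun x : M => TotalSpace.mk' (F →L[ℝ] E)
      (E := fun x : M => V x →L[ℝ] TangentSpace 𝓘(ℝ, E) x) x (anchor x))
  /-- The Loday bracket `X * Y` of smooth sections. -/
  bracket : Cₛ^∞⟮𝓘(ℝ, E); F, V⟯ →ₗ[ℝ] Cₛ^∞⟮𝓘(ℝ, E); F, V⟯ →ₗ[ℝ] Cₛ^∞⟮𝓘(ℝ, E); F, V⟯
  /-- `X * (Y * Z) = (X * Y) * Z + Y * (X * Z)`. -/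
  jacobi : ∀ X Y Z : Cₛ^∞⟮𝓘(ℝ, E); F, V⟯,
    bracket X (bracket Y Z) = bracket (bracket X Y) Z + bracket Y (bracket X Z)
  /-- `a(X)⟨Y, Z⟩ = ⟨X, Y * Z + Z * Y⟩`. -/
  anchor_pairing_symm : ∀ (X Y Z : Cₛ^∞⟮𝓘(ℝ, E); F, V⟯) (x : M),
    mfderiv 𝓘(ℝ, E) 𝓘(ℝ, ℝ) (fun y : M => pairing y (Y y) (Z y)) x (anchor x (X x)) =
      pairing x (X x) (bracket Y Z x + bracket Z Y x)
  /-- `a(X)⟨Y, Z⟩ = ⟨X * Y, Z⟩ + ⟨Y, X * Z⟩`. -/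
  anchor_pairing : ∀ (X Y Z : Cₛ^∞⟮𝓘(ℝ, E); F, V⟯) (x : M),
    mfderiv 𝓘(ℝ, E) 𝓘(ℝ, ℝ) (fun y : M => pairing y (Y y) (Z y)) x (anchor x (X x)) =
      pairing x (bracket X Y x) (Z x) + pairing x (Y x) (bracket X Z x)

variable (E F V) in
/-- An extended tangent bundle (exact Courant algebroid): a Courant algebroid fitting into the exact
sequence `0 → T*M --a*--> V --a--> TM → 0`. The map `a*` is the transpose of the anchor, where `V`
is identified with its dual by `2⟨ , ⟩`; it is determined by `two_pairing_coanchor`. -/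
structure ExtendedTangentBundle extends CourantAlgebroid E F V where
  /-- The map `a* : T*M → V`. -/
  coanchor : ∀ x : M, (TangentSpace 𝓘(ℝ, E) x →L[ℝ] ℝ) →ₗ[ℝ] V x
  two_pairing_coanchor : ∀ (x : M) (ξ : TangentSpace 𝓘(ℝ, E) x →L[ℝ] ℝ) (v : V x),
    2 * pairing x (coanchor x ξ) v = ξ (anchor x v)
  coanchor_injective : ∀ x : M, Function.Injective (coanchor x)
  exact : ∀ (x : M) (v : V x), anchor x v = 0 ↔ ∃ ξ, coanchor x ξ = v
  anchor_surjective : ∀ x : M, Function.Surjective (anchor x)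

/-- The anchor as a map of total spaces `V → TM`. -/
def CourantAlgebroid.anchorTotal (A : CourantAlgebroid E F V) (p : TotalSpace F V) :
    TangentBundle 𝓘(ℝ, E) M :=
  ⟨p.1, A.anchor p.1 p.2⟩

/-- An isotropic splitting of an extended tangent bundle: a smooth bundle map `s : TM → V` with
`a ∘ s = id` and isotropic image. -/
structure IsotropicSplitting (A : ExtendedTangentBundle E F V) where
  toFun : ∀ x : M, TangentSpace 𝓘(ℝ, E) x →L[ℝ] V x
  smooth : ContMDiff 𝓘(ℝ, E) (𝓘(ℝ, E).prod 𝓘(ℝ, E →L[ℝ] F)) ∞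
    (fun x : M => TotalSpace.mk' (E →L[ℝ] F)
      (E := fun x : M => TangentSpace 𝓘(ℝ, E) x →L[ℝ] V x) x (toFun x))
  anchor_comp : ∀ (x : M) (X : TangentSpace 𝓘(ℝ, E) x), A.anchor x (toFun x X) = X
  isotropic : ∀ (x : M) (X Y : TangentSpace 𝓘(ℝ, E) x), A.pairing x (toFun x X) (toFun x Y) = 0

end Structures

section Automorphisms

variable {E : Type*} [NormedAddCommGroup E] [NormedSpace ℝ E]
  {M : Type*} [TopologicalSpace M] [ChartedSpace E M]
  {F : Type*} [NormedAddCommGroup F] [NormedSpace ℝ F]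
  {V : M → Type*} [TopologicalSpace (TotalSpace F V)]
  [∀ x, AddCommGroup (V x)] [∀ x, Module ℝ (V x)] [∀ x, TopologicalSpace (V x)]
  [FiberBundle F V]

variable (E F V) in
/-- A smooth automorphism of the vector bundle `V → M`: a diffeomorphism `total` of the total space
that covers a diffeomorphism `base` of `M` and is linear on the fibres. -/
structure BundleAut where
  base : M ≃ₘ^∞⟮𝓘(ℝ, E), 𝓘(ℝ, E)⟯ M
  total : TotalSpace F V ≃ₘ^∞⟮𝓘(ℝ, E).prod 𝓘(ℝ, F), 𝓘(ℝ, E).prod 𝓘(ℝ, F)⟯ TotalSpace F V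
  linear : ∀ x : M, ∃ L : V x →ₗ[ℝ] V (base x),
    ∀ v : V x, total ⟨x, v⟩ = (⟨base x, L v⟩ : TotalSpace F V)

namespace BundleAut

/-- The linear map `V x → V (base x)` on the fibre at `x` given by a bundle automorphism. -/
def fibre (φ : BundleAut E F V) (x : M) : V x →ₗ[ℝ] V (φ.base x) := (φ.linear x).choose

theorem total_mk (φ : BundleAut E F V) (x : M) (v : V x) :
    φ.total ⟨x, v⟩ = (⟨φ.base x, φ.fibre x v⟩ : TotalSpace F V) :=
  (φ.linear x).choose_spec v

theorem total_proj (φ : BundleAut E F V) (p : TotalSpace F V) :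
    (φ.total p).proj = φ.base p.proj := by
  obtain ⟨x, v⟩ := p
  rw [φ.total_mk]

theorem ext_total {φ ψ : BundleAut E F V} (h : ∀ p, φ.total p = ψ.total p) : φ = ψ := by
  have h1 : φ.total = ψ.total := Diffeomorph.ext h
  have h2 : φ.base = ψ.base := by
    apply Diffeomorph.ext
    intro x
    have := φ.total_proj ⟨x, 0⟩
    rw [h, ψ.total_proj] at this
    exact this.symm
  obtain ⟨a, b, c⟩ := φ
  obtain ⟨a', b', c'⟩ := ψ
  simp only at h1 h2
  subst h1 h2
  rfl

instance : One (BundleAut E F V) where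
  one :=
    { base := Diffeomorph.refl _ _ _
      total := Diffeomorph.refl _ _ _
      linear := fun _ => ⟨LinearMap.id, fun _ => rfl⟩ }

/-- Composition of bundle automorphisms: `(φ * ψ)(v) = φ (ψ v)`. -/
instance : Mul (BundleAut E F V) where
  mul φ ψ :=
    { base := ψ.base.trans φ.base
      total := ψ.total.trans φ.total
      linear := fun x => ⟨(φ.fibre (ψ.base x)).comp (ψ.fibre x), fun v => by
        change φ.total (ψ.total ⟨x, v⟩) = _
        rw [ψ.total_mk, φ.total_mk]
        rfl⟩ }

instance : Inv (BundleAut E F V) where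
  inv φ :=
    { base := φ.base.symm
      total := φ.total.symm
      linear := fun x => by
        obtain ⟨y, rfl⟩ := EquivLike.surjective φ.base x
        change ∃ L : V (φ.base y) →ₗ[ℝ] V (φ.base.symm (φ.base y)), ∀ v : V (φ.base y),
          φ.total.symm ⟨φ.base y, v⟩ = (⟨φ.base.symm (φ.base y), L v⟩ : TotalSpace F V)
        rw [φ.base.symm_apply_apply]
        have hinj : Function.Injective (φ.fibre y) := by
          intro v w hvw
          have h : φ.total ⟨y, v⟩ = φ.total ⟨y, w⟩ := by
            rw [φ.total_mk, φ.total_mk, hvw]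
          have h' := EquivLike.injective φ.total h
          exact TotalSpace.mk_injective y h'
        have hsurj : Function.Surjective (φ.fibre y) := by
          intro w
          obtain ⟨⟨z, v⟩, hp⟩ := EquivLike.surjective φ.total ⟨φ.base y, w⟩
          rw [φ.total_mk] at hp
          have hz : z = y := φ.base.injective (congrArg TotalSpace.proj hp)
          subst hz
          exact ⟨v, TotalSpace.mk_injective _ hp⟩
        refine ⟨(LinearEquiv.ofBijective (φ.fibre y) ⟨hinj, hsurj⟩).symm.toLinearMap, fun v => ?_⟩
        apply EquivLike.injective φ.total
        rw [φ.total.apply_symm_apply, φ.total_mk]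
        congr 1
        exact ((LinearEquiv.ofBijective (φ.fibre y) ⟨hinj, hsurj⟩).apply_symm_apply v).symm }

theorem one_total (p : TotalSpace F V) : (1 : BundleAut E F V).total p = p := rfl

theorem mul_total (φ ψ : BundleAut E F V) (p : TotalSpace F V) :
    (φ * ψ).total p = φ.total (ψ.total p) := rfl

theorem inv_total (φ : BundleAut E F V) (p : TotalSpace F V) :
    (φ⁻¹).total p = φ.total.symm p := rfl

theorem one_base (x : M) : (1 : BundleAut E F V).base x = x := rfl

theorem mul_base (φ ψ : BundleAut E F V) (x : M) : (φ * ψ).base x = φ.base (ψ.base x) := rfl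

theorem inv_base (φ : BundleAut E F V) (x : M) : (φ⁻¹).base x = φ.base.symm x := rfl

/-- The group of smooth automorphisms of a vector bundle, under composition. -/
instance : Group (BundleAut E F V) :=
  Group.ofLeftAxioms (fun _ _ _ => ext_total fun _ => rfl) (fun _ => ext_total fun _ => rfl)
    (fun φ => ext_total fun p => φ.total.symm_apply_apply p)

/-- The value at `x` of the push-forward of a section, as an element of the fibre at `x`. -/
theorem exists_pushforward_value (φ : BundleAut E F V) (X : Cₛ^∞⟮𝓘(ℝ, E); F, V⟯) (x : M) :
    ∃ w : V x, (⟨x, w⟩ : TotalSpace F V) = φ.total ⟨φ.base.symm x, X (φ.base.symm x)⟩ := by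
  have h : (φ.total ⟨φ.base.symm x, X (φ.base.symm x)⟩).proj = x := by
    rw [φ.total_proj]
    exact φ.base.apply_symm_apply x
  generalize φ.total ⟨φ.base.symm x, X (φ.base.symm x)⟩ = p at h
  obtain ⟨y, w⟩ := p
  simp only at h
  subst h
  exact ⟨w, rfl⟩

/-- The push-forward `φ ∘ X ∘ base⁻¹` of a smooth section `X` by a bundle automorphism `φ`. -/
def pushforward (φ : BundleAut E F V) (X : Cₛ^∞⟮𝓘(ℝ, E); F, V⟯) : Cₛ^∞⟮𝓘(ℝ, E); F, V⟯ where
  toFun x := (φ.exists_pushforward_value X x).choose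
  contMDiff_toFun := by
    have h : (fun x : M => TotalSpace.mk' F x (φ.exists_pushforward_value X x).choose) =
        fun x => φ.total (TotalSpace.mk' F (φ.base.symm x) (X (φ.base.symm x))) :=
      funext fun x => (φ.exists_pushforward_value X x).choose_spec
    rw [h]
    exact φ.total.contMDiff.comp (X.contMDiff.comp φ.base.symm.contMDiff)

theorem mk_pushforward (φ : BundleAut E F V) (X : Cₛ^∞⟮𝓘(ℝ, E); F, V⟯) (x : M) :
    (⟨x, φ.pushforward X x⟩ : TotalSpace F V) =
      φ.total ⟨φ.base.symm x, X (φ.base.symm x)⟩ :=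
  (φ.exists_pushforward_value X x).choose_spec

theorem section_ext {X Y : Cₛ^∞⟮𝓘(ℝ, E); F, V⟯}
    (h : ∀ x, (⟨x, X x⟩ : TotalSpace F V) = ⟨x, Y x⟩) : X = Y :=
  ContMDiffSection.ext fun x => TotalSpace.mk_injective x (h x)

theorem pushforward_one (X : Cₛ^∞⟮𝓘(ℝ, E); F, V⟯) :
    (1 : BundleAut E F V).pushforward X = X :=
  section_ext fun x => mk_pushforward 1 X x

theorem pushforward_mul (φ ψ : BundleAut E F V) (X : Cₛ^∞⟮𝓘(ℝ, E); F, V⟯) :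
    (φ * ψ).pushforward X = φ.pushforward (ψ.pushforward X) :=
  section_ext fun x => by
    rw [mk_pushforward, mk_pushforward, mk_pushforward]
    rfl

/-- `φ` preserves a pairing iff it does so on any two vectors of a fibre and their images. -/
theorem pairing_iff (P : ∀ x : M, V x → V x → ℝ) (φ : BundleAut E F V) :
    (∀ (x : M) (v w : V x), P (φ.base x) (φ.fibre x v) (φ.fibre x w) = P x v w) ↔
      ∀ (x y : M) (v w : V x) (v' w' : V y), φ.total ⟨x, v⟩ = ⟨y, v'⟩ →
        φ.total ⟨x, w⟩ = ⟨y, w'⟩ → P y v' w' = P x v w := by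
  constructor
  · intro h x y v w v' w' h1 h2
    rw [φ.total_mk] at h1 h2
    have hy : φ.base x = y := congrArg TotalSpace.proj h1
    subst hy
    rw [← TotalSpace.mk_injective _ h1, ← TotalSpace.mk_injective _ h2]
    exact h x v w
  · intro h x v w
    exact h x _ v w _ _ (φ.total_mk x v) (φ.total_mk x w)

end BundleAut

end Automorphisms

section Symmetries

variable {E : Type*} [NormedAddCommGroup E] [NormedSpace ℝ E]
  {M : Type*} [TopologicalSpace M] [ChartedSpace E M] [IsManifold 𝓘(ℝ, E) ∞ M]
  {F : Type*} [NormedAddCommGroup F] [NormedSpace ℝ F]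
  {V : M → Type*} [TopologicalSpace (TotalSpace F V)]
  [∀ x, AddCommGroup (V x)] [∀ x, Module ℝ (V x)] [∀ x, TopologicalSpace (V x)]
  [∀ x, IsTopologicalAddGroup (V x)] [∀ x, ContinuousSMul ℝ (V x)]
  [FiberBundle F V] [VectorBundle ℝ F V]

/-- `φ` is a symmetry of the Courant algebroid `A`: it preserves the pairing, intertwines the anchor
with the differential of the underlying diffeomorphism, and preserves the Loday bracket. -/
structure IsCourantSymmetry (A : CourantAlgebroid E F V) (φ : BundleAut E F V) : Prop where
  pairing : ∀ (x : M) (v w : V x),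
    A.pairing (φ.base x) (φ.fibre x v) (φ.fibre x w) = A.pairing x v w
  anchor : ∀ p : TotalSpace F V,
    A.anchorTotal (φ.total p) = tangentMap 𝓘(ℝ, E) 𝓘(ℝ, E) φ.base (A.anchorTotal p)
  bracket : ∀ X Y : Cₛ^∞⟮𝓘(ℝ, E); F, V⟯,
    φ.pushforward (A.bracket X Y) = A.bracket (φ.pushforward X) (φ.pushforward Y)

/-- The group of symmetries of a Courant algebroid. -/
def symmetryGroup (A : CourantAlgebroid E F V) : Subgroup (BundleAut E F V) where
  carrier := {φ | IsCourantSymmetry A φ}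
  one_mem' := by
    refine ⟨?_, ?_, ?_⟩
    · rw [BundleAut.pairing_iff (fun x v w => A.pairing x v w)]
      intro x y v w v' w' h1 h2
      rw [BundleAut.one_total] at h1 h2
      have hy : x = y := congrArg TotalSpace.proj h1
      subst hy
      rw [TotalSpace.mk_injective _ h1, TotalSpace.mk_injective _ h2]
    · intro p
      change A.anchorTotal p = tangentMap 𝓘(ℝ, E) 𝓘(ℝ, E) id (A.anchorTotal p)
      rw [tangentMap_id]
      rfl
    · intro X Y
      simp only [BundleAut.pushforward_one]
  mul_mem' := by
    rintro φ ψ ⟨h1, h2, h3⟩ ⟨k1, k2, k3⟩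
    refine ⟨?_, ?_, ?_⟩
    · rw [BundleAut.pairing_iff (fun x v w => A.pairing x v w)] at h1 k1 ⊢
      intro x y v w v' w' e1 e2
      rw [BundleAut.mul_total, BundleAut.total_mk ψ] at e1 e2
      rw [h1 _ _ _ _ _ _ e1 e2]
      exact k1 _ _ _ _ _ _ (ψ.total_mk x v) (ψ.total_mk x w)
    · intro p
      rw [BundleAut.mul_total, h2, k2]
      change _ = tangentMap 𝓘(ℝ, E) 𝓘(ℝ, E) (φ.base ∘ ψ.base) (A.anchorTotal p)
      rw [tangentMap_comp (φ.base.mdifferentiable (by simp)) (ψ.base.mdifferentiable (by simp))]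
      rfl
    · intro X Y
      rw [BundleAut.pushforward_mul, k3, h3, ← BundleAut.pushforward_mul,
        ← BundleAut.pushforward_mul]
  inv_mem' := by
    rintro φ ⟨h1, h2, h3⟩
    refine ⟨?_, ?_, ?_⟩
    · rw [BundleAut.pairing_iff (fun x v w => A.pairing x v w)] at h1 ⊢
      intro x y v w v' w' e1 e2
      rw [BundleAut.inv_total] at e1 e2
      refine (h1 _ _ _ _ _ _ ?_ ?_).symm
      · rw [← e1, φ.total.apply_symm_apply]
      · rw [← e2, φ.total.apply_symm_apply]
    · intro p
      obtain ⟨q, rfl⟩ := EquivLike.surjective φ.total p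
      have hq : (φ⁻¹).total (φ.total q) = q := φ.total.symm_apply_apply q
      rw [hq, h2]
      have hc : tangentMap 𝓘(ℝ, E) 𝓘(ℝ, E) ((φ⁻¹).base ∘ φ.base) = id := by
        have : ((φ⁻¹).base ∘ φ.base : M → M) = id := funext fun x => φ.base.symm_apply_apply x
        rw [this, tangentMap_id]
      rw [tangentMap_comp ((φ⁻¹).base.mdifferentiable (by simp))
        (φ.base.mdifferentiable (by simp))] at hc
      exact (congrFun hc (A.anchorTotal q)).symm
    · intro X Y
      have hinv : ∀ Z : Cₛ^∞⟮𝓘(ℝ, E); F, V⟯, φ.pushforward ((φ⁻¹).pushforward Z) = Z := by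
        intro Z
        rw [← BundleAut.pushforward_mul, mul_inv_cancel, BundleAut.pushforward_one]
      have hinv' : ∀ Z : Cₛ^∞⟮𝓘(ℝ, E); F, V⟯, (φ⁻¹).pushforward (φ.pushforward Z) = Z := by
        intro Z
        rw [← BundleAut.pushforward_mul, inv_mul_cancel, BundleAut.pushforward_one]
      have h := h3 ((φ⁻¹).pushforward X) ((φ⁻¹).pushforward Y)
      rw [hinv, hinv] at h
      rw [← h, hinv']

/-- An action of the Lie group `G` (modelled on `E'`) on the extended tangent bundle `A`: a
homomorphism to the symmetry group of `A` whose action map `G × V → V` is smooth. -/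
structure LieGroupAction (E' : Type*) [NormedAddCommGroup E'] [NormedSpace ℝ E']
    (G : Type*) [Group G] [TopologicalSpace G] [ChartedSpace E' G]
    (A : ExtendedTangentBundle E F V) where
  hom : G →* symmetryGroup A.toCourantAlgebroid
  smooth : ContMDiff (𝓘(ℝ, E').prod (𝓘(ℝ, E).prod 𝓘(ℝ, F))) (𝓘(ℝ, E).prod 𝓘(ℝ, F)) ∞
    (fun p : G × TotalSpace F V => (hom p.1 : BundleAut E F V).total p.2)

/-- A symmetry `φ` covering `λ` preserves the isotropic splitting `s` if, under the identification
`TM ⊕ T*M ≃ V`, `X + ξ ↦ s X + a* ξ`, it acts as the diffeomorphism `λ` alone, i.e.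
`φ (X + ξ) = λ_* X + (λ⁻¹)^* ξ`. Here `ξ` is written as `λ^* η`. -/
def IsotropicSplitting.PreservedBy {A : ExtendedTangentBundle E F V} (s : IsotropicSplitting A)
    (φ : BundleAut E F V) : Prop :=
  ∀ (x : M) (X : TangentSpace 𝓘(ℝ, E) x) (η : TangentSpace 𝓘(ℝ, E) (φ.base x) →L[ℝ] ℝ),
    φ.fibre x (s.toFun x X + A.coanchor x (η.comp (mfderiv 𝓘(ℝ, E) 𝓘(ℝ, E) φ.base x))) =
      s.toFun (φ.base x) (mfderiv 𝓘(ℝ, E) 𝓘(ℝ, E) φ.base x X) + A.coanchor (φ.base x) η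

end Symmetries

end CourantGeometry

end

/-! Isotropy is quadratic in a splitting `s`, so isotropic splittings cannot be averaged naively.
The remedy is to encode `s` by the bilinear form R(X, w) = ⟨s X, w⟩ on TM × V. For such R, being a
right inverse of the anchor and having isotropic image together amount to the single affine identity
R(a v, w) + R(a w, v) = ⟨v, w⟩ (`IsSplittingForm`). Its solutions at a point form a convex set.

Convexity is used twice. Local solutions, built from a local right inverse of the anchor, are glued
by a partition of unity (`exists_isSplittingForm`). The result is then averaged over G against
normalised Haar measure (`exists_invariant_isSplittingForm`). Each symmetry preserves the pairing
and intertwines the anchor, so it carries solutions to solutions, and the average is an invariant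
solution.

Smoothness of the average is differentiation under the integral sign. The tangent argument is lifted
to a section of V, so that the differential of the base map is replaced by the given smooth action
on V.

Finally, non-degeneracy of the pairing turns the invariant form back into a splitting
(`exists_isotropicSplitting_of_form`), and invariance of the form is enough for the symmetries to
preserve it (`preservedBy_of_pairing`). -/

set_option linter.unusedSectionVars false

/-! ### Smooth dependence of integrals over a compact manifold on a parameter. -/

section ParametricIntegral

open MeasureTheory Filter Topology Set

variable {W : Type*} [NormedAddCommGroup W]
  {G : Type*} [TopologicalSpace G] [CompactSpace G] [MeasurableSpace G] [BorelSpace G]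
  {μ : Measure G} [IsFiniteMeasure μ]

theorem Continuous.integrable_of_compactSpace {f : G → W} (hf : Continuous f) :
    Integrable f μ :=
  hf.integrable_of_hasCompactSupport (HasCompactSupport.of_compactSpace f)

variable [NormedSpace ℝ W]
  {H : Type*} [NormedAddCommGroup H] [NormedSpace ℝ H] [FiniteDimensional ℝ H]

/-- Differentiation under the integral sign over a compact space. -/
theorem hasFDerivAt_integral_of_continuousOn {U : Set H} (hU : IsOpen U) {f : G → H → W}
    {f' : G → H → H →L[ℝ] W} (hf : ContinuousOn (Function.uncurry f) (univ ×ˢ U))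
    (hf' : ContinuousOn (Function.uncurry f') (univ ×ˢ U))
    (h : ∀ g, ∀ x ∈ U, HasFDerivAt (f g) (f' g x) x) {x₀ : H} (hx₀ : x₀ ∈ U) :
    HasFDerivAt (fun x => ∫ g, f g x ∂μ) (∫ g, f' g x₀ ∂μ) x₀ := by
  have hc : ∀ x ∈ U, Continuous fun g => f g x := fun x hx =>
    hf.comp_continuous (f := fun g => (g, x)) (by fun_prop) (fun g => ⟨mem_univ _, hx⟩)
  have hc' : ∀ x ∈ U, Continuous fun g => f' g x := fun x hx =>
    hf'.comp_continuous (f := fun g => (g, x)) (by fun_prop) (fun g => ⟨mem_univ _, hx⟩)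
  obtain ⟨K, hK, hKx, hKU⟩ : ∃ K : Set H, IsCompact K ∧ x₀ ∈ interior K ∧ K ⊆ U :=
    exists_compact_subset hU hx₀
  -- Compactness of G × K bounds the derivative uniformly, and a constant dominates because the
  -- measure is finite.
  obtain ⟨C, hC⟩ := (isCompact_univ.prod hK).exists_bound_of_continuousOn
    (hf'.mono (prod_mono_right hKU))
  refine hasFDerivAt_integral_of_dominated_of_fderiv_le (F' := fun x g => f' g x)
    (s := K) (bound := fun _ => C) (mem_interior_iff_mem_nhds.1 hKx) ?_
    (hc x₀ hx₀).integrable_of_compactSpace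
    (hc' x₀ hx₀).integrable_of_compactSpace.aestronglyMeasurable
    (.of_forall fun g x hx => hC (g, x) ⟨mem_univ _, hx⟩) (integrable_const C)
    (.of_forall fun g x hx => h g x (hKU hx))
  filter_upwards [hU.mem_nhds hx₀] with x hx
  exact (hc x hx).integrable_of_compactSpace.aestronglyMeasurable

variable {E' : Type*} [NormedAddCommGroup E'] [NormedSpace ℝ E'] [ChartedSpace E' G]
  [IsManifold 𝓘(ℝ, E') ∞ G]

/-- The integral over a compact manifold of a smooth function depending smoothly on a parameter
is a smooth function of the parameter. -/
theorem contDiffOn_integral_of_contMDiffAt [CompleteSpace W] {U : Set H} (hU : IsOpen U)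
    {f : G → H → W}
    (hf : ∀ g, ∀ x ∈ U, ContMDiffAt (𝓘(ℝ, E').prod 𝓘(ℝ, H)) 𝓘(ℝ, W) ∞
      (Function.uncurry f) (g, x)) :
    ContDiffOn ℝ ∞ (fun x => ∫ g, f g x ∂μ) U := by
  have key : ∀ f : G → H → W, (∀ g, ∀ x ∈ U, ContMDiffAt (𝓘(ℝ, E').prod 𝓘(ℝ, H)) 𝓘(ℝ, W) ∞
      (Function.uncurry f) (g, x)) →
      (∀ g, ∀ x ∈ U, ContMDiffAt (𝓘(ℝ, E').prod 𝓘(ℝ, H)) 𝓘(ℝ, H →L[ℝ] W) ∞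
        (fun p : G × H => fderiv ℝ (f p.1) p.2) (g, x)) ∧
      ∀ x ∈ U, HasFDerivAt (fun x => ∫ g, f g x ∂μ) (∫ g, fderiv ℝ (f g) x ∂μ) x := by
    intro f hf
    have h1 : ∀ g, ∀ x ∈ U, ContMDiffAt (𝓘(ℝ, E').prod 𝓘(ℝ, H)) 𝓘(ℝ, H →L[ℝ] W) ∞
        (fun p : G × H => fderiv ℝ (f p.1) p.2) (g, x) := by
      intro g x hx
      -- The point of differentiation is made part of the parameter: the family is indexed by G × H
      -- and differentiated at the second component, which gives joint smoothness of the partial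
      -- derivative.
      have h0 : ContMDiffAt ((𝓘(ℝ, E').prod 𝓘(ℝ, H)).prod 𝓘(ℝ, H)) 𝓘(ℝ, W) ∞
          (Function.uncurry fun p : G × H => f p.1) ((g, x), x) :=
        ContMDiffAt.comp (f := fun q : (G × H) × H => (q.1.1, q.2)) ((g, x), x) (hf g x hx)
          (contMDiffAt_fst.fst.prodMk contMDiffAt_snd)
      have h2 := ContMDiffAt.mfderiv (I := 𝓘(ℝ, H)) (I' := 𝓘(ℝ, W)) (x₀ := (g, x)) (m := ∞) (n := ∞)
        (J := 𝓘(ℝ, E').prod 𝓘(ℝ, H))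
        (fun p : G × H => f p.1) Prod.snd
        h0 contMDiffAt_snd (by simp)
      have h3 := inTangentCoordinates_model_space (I := 𝓘(ℝ, H)) (I' := 𝓘(ℝ, W)) (Prod.snd : G × H → H)
        (fun p : G × H => f p.1 p.2) (fun p : G × H => fderiv ℝ (f p.1) p.2) (g, x)
      rw [← h3]
      simpa only [mfderiv_eq_fderiv] using! h2
    refine ⟨h1, fun x hx => hasFDerivAt_integral_of_continuousOn hU
      (f' := fun g x => fderiv ℝ (f g) x)
      (fun p hp => (hf p.1 p.2 hp.2).continuousAt.continuousWithinAt)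
      (fun p hp => (h1 p.1 p.2 hp.2).continuousAt.continuousWithinAt) (fun g x hx => ?_) hx⟩
    have h3 : ContMDiffAt 𝓘(ℝ, H) 𝓘(ℝ, W) ∞ (f g) x :=
      ContMDiffAt.comp (f := fun y : H => (g, y)) x (hf g x hx)
        (contMDiffAt_const.prodMk contMDiffAt_id)
    exact (h3.contDiffAt.differentiableAt (by simp)).hasFDerivAt
  rw [contDiffOn_infty]
  intro n
  induction n generalizing f with
  | zero =>
    exact contDiffOn_zero.2 fun x hx => ((key f hf).2 x hx).continuousAt.continuousWithinAt
  | succ n ih =>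
    push_cast
    -- Testing the derivative on a fixed vector keeps the values in W, so the induction hypothesis
    -- applies without changing the target space.
    rw [contDiffOn_succ_iff_fderiv_apply hU.uniqueDiffOn]
    refine ⟨fun x hx => ((key f hf).2 x hx).differentiableAt.differentiableWithinAt,
      fun h => absurd h (by simp), fun y => ?_⟩
    have h4 : ∀ g, ∀ x ∈ U, ContMDiffAt (𝓘(ℝ, E').prod 𝓘(ℝ, H)) 𝓘(ℝ, W) ∞
        (Function.uncurry fun g x => fderiv ℝ (f g) x y) (g, x) := fun g x hx =>
      ((key f hf).1 g x hx).clm_apply contMDiffAt_const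
    refine (ih h4).congr fun x hx => ?_
    rw [fderivWithin_of_isOpen hU hx, ((key f hf).2 x hx).fderiv,
      ContinuousLinearMap.integral_apply]
    refine Continuous.integrable_of_compactSpace (continuous_iff_continuousAt.2 fun g => ?_)
    exact ContinuousAt.comp (f := fun g => (g, x)) ((key f hf).1 g x hx).continuousAt
      (by fun_prop)

variable {E : Type*} [NormedAddCommGroup E] [NormedSpace ℝ E] [FiniteDimensional ℝ E]
  {M : Type*} [TopologicalSpace M] [ChartedSpace E M] [IsManifold 𝓘(ℝ, E) ∞ M]

/-- Reduction to the vector space case in a chart. The neighbourhood of `x₀` must serve all g at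
once, hence the order of the quantifiers. -/
theorem contMDiffAt_integral [CompleteSpace W] {f : G → M → W} {x₀ : M}
    (hf : ∀ᶠ x in 𝓝 x₀, ∀ g, ContMDiffAt (𝓘(ℝ, E').prod 𝓘(ℝ, E)) 𝓘(ℝ, W) ∞
      (Function.uncurry f) (g, x)) :
    ContMDiffAt 𝓘(ℝ, E) 𝓘(ℝ, W) ∞ (fun x => ∫ g, f g x ∂μ) x₀ := by
  obtain ⟨O, hO, hOo, hxO⟩ := eventually_nhds_iff.1 hf
  set e := chartAt E x₀
  have hx₀ : x₀ ∈ e.source := mem_chart_source E x₀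
  have hU : IsOpen (e.target ∩ e.symm ⁻¹' O) := e.isOpen_inter_preimage_symm hOo
  have hs := contMDiffOn_chart_symm (I := 𝓘(ℝ, E)) (n := ∞) (x := x₀)
  have h := contDiffOn_integral_of_contMDiffAt (E' := E') (μ := μ) hU
    (f := fun g y => f g (e.symm y)) fun g x hx =>
      ContMDiffAt.comp (f := fun p : G × E => (p.1, e.symm p.2)) (g, x) (hO _ hx.2 g)
        (contMDiffAt_fst.prodMk (ContMDiffAt.comp (f := Prod.snd) (g := e.symm) (g, x)
          (hs.contMDiffAt (e.open_target.mem_nhds hx.1)) contMDiffAt_snd))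
  have hy : e x₀ ∈ e.target ∩ e.symm ⁻¹' O :=
    ⟨e.map_source hx₀, by simpa [e.left_inv hx₀] using hxO⟩
  have h2 := (h.contDiffAt (hU.mem_nhds hy)).contMDiffAt.comp x₀
    (contMDiffAt_of_mem_maximalAtlas (I := 𝓘(ℝ, E)) (IsManifold.chart_mem_maximalAtlas x₀) hx₀)
  refine h2.congr_of_eventuallyEq ?_
  filter_upwards [e.open_source.mem_nhds hx₀] with x hx
  simp only [Function.comp_apply, e.left_inv hx]

end ParametricIntegral

/-! ### Smoothness and inversion of sections of bundles of linear maps. -/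

section HomBundle

open Filter Topology ContinuousLinearMap

variable {E : Type*} [NormedAddCommGroup E] [NormedSpace ℝ E]
  {M : Type*} [TopologicalSpace M] [ChartedSpace E M]
  {F₁ : Type*} [NormedAddCommGroup F₁] [NormedSpace ℝ F₁]
  {F₂ : Type*} [NormedAddCommGroup F₂] [NormedSpace ℝ F₂]

/-- With a basis of `F₁`, the space of linear maps becomes a finite power of `F₂`, where smoothness
is componentwise. -/
theorem contMDiffAt_clm_of_apply [FiniteDimensional ℝ F₁] {f : M → F₁ →L[ℝ] F₂} {x₀ : M}
    {n : WithTop ℕ∞} (h : ∀ y, ContMDiffAt 𝓘(ℝ, E) 𝓘(ℝ, F₂) n (fun x => f x y) x₀) :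
    ContMDiffAt 𝓘(ℝ, E) 𝓘(ℝ, F₁ →L[ℝ] F₂) n f x₀ := by
  let d := Module.finrank ℝ F₁
  have hd : d = Module.finrank ℝ (Fin d → ℝ) := (Module.finrank_fin_fun ℝ).symm
  let e₁ := ContinuousLinearEquiv.ofFinrankEq hd
  let e₂ := (e₁.arrowCongr (1 : F₂ ≃L[ℝ] F₂)).trans (ContinuousLinearEquiv.piRing (Fin d))
  rw [← Function.id_comp f, ← e₂.symm_comp_self]
  exact e₂.symm.contDiff.contMDiff.contMDiffAt.comp x₀
    (contMDiffAt_pi_space.2 fun i => h _)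

variable {E₁ : M → Type*} [TopologicalSpace (TotalSpace F₁ E₁)]
  [∀ x, AddCommGroup (E₁ x)] [∀ x, Module ℝ (E₁ x)] [∀ x, TopologicalSpace (E₁ x)]
  [FiberBundle F₁ E₁] [VectorBundle ℝ F₁ E₁]
  {E₂ : M → Type*} [TopologicalSpace (TotalSpace F₂ E₂)]
  [∀ x, AddCommGroup (E₂ x)] [∀ x, Module ℝ (E₂ x)] [∀ x, TopologicalSpace (E₂ x)]
  [∀ x, IsTopologicalAddGroup (E₂ x)] [∀ x, ContinuousSMul ℝ (E₂ x)]
  [FiberBundle F₂ E₂] [VectorBundle ℝ F₂ E₂]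

/-- A section of a bundle of continuous linear maps is smooth at a point as soon as its values on
the sections that are constant in the preferred trivialization are. -/
theorem contMDiffAt_hom_of_apply [FiniteDimensional ℝ F₁] {φ : ∀ x, E₁ x →L[ℝ] E₂ x} {x₀ : M}
    (h : ∀ y : F₁, ContMDiffAt 𝓘(ℝ, E) (𝓘(ℝ, E).prod 𝓘(ℝ, F₂)) ∞
      (fun x => TotalSpace.mk' F₂ x (φ x ((trivializationAt F₁ E₁ x₀).symm x y))) x₀) :
    ContMDiffAt 𝓘(ℝ, E) (𝓘(ℝ, E).prod 𝓘(ℝ, F₁ →L[ℝ] F₂)) ∞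
      (fun x => TotalSpace.mk' (F₁ →L[ℝ] F₂) (E := fun x => E₁ x →L[ℝ] E₂ x) x (φ x)) x₀ := by
  rw [contMDiffAt_hom_bundle]
  refine ⟨contMDiffAt_id, contMDiffAt_clm_of_apply fun y => ?_⟩
  refine ((contMDiffAt_section x₀).1 (h y)).congr_of_eventuallyEq ?_
  filter_upwards [(trivializationAt F₁ E₁ x₀).open_baseSet.mem_nhds
      (mem_baseSet_trivializationAt F₁ E₁ x₀), (trivializationAt F₂ E₂ x₀).open_baseSet.mem_nhds
      (mem_baseSet_trivializationAt F₂ E₂ x₀)] with x hx hx'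
  rw [inCoordinates_eq hx hx']
  simp

/-- Constant sections in the preferred trivialization are smooth. -/
theorem contMDiffAt_trivializationAt_symm [ContMDiffVectorBundle ∞ F₁ E₁ 𝓘(ℝ, E)]
    {x₀ x : M} (hx : x ∈ (trivializationAt F₁ E₁ x₀).baseSet) (y : F₁) :
    ContMDiffAt 𝓘(ℝ, E) (𝓘(ℝ, E).prod 𝓘(ℝ, F₁)) ∞
      (fun x => TotalSpace.mk' F₁ x ((trivializationAt F₁ E₁ x₀).symm x y)) x := by
  set e := trivializationAt F₁ E₁ x₀
  refine (e.contMDiffAt_iff (e.mem_source.2 hx)).2 ⟨contMDiffAt_id,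
    (contMDiffAt_const (c := y)).congr_of_eventuallyEq ?_⟩
  filter_upwards [e.open_baseSet.mem_nhds hx] with x' hx'
  exact congrArg Prod.snd (e.apply_mk_symm hx' y)

/-- Every vector of a smooth vector bundle is the value of a section that is smooth at its base
point. -/
theorem exists_section_contMDiffAt [ContMDiffVectorBundle ∞ F₁ E₁ 𝓘(ℝ, E)] (x₀ : M) (v₀ : E₁ x₀) :
    ∃ v : ∀ x, E₁ x, v x₀ = v₀ ∧
      ContMDiffAt 𝓘(ℝ, E) (𝓘(ℝ, E).prod 𝓘(ℝ, F₁)) ∞ (fun x => TotalSpace.mk' F₁ x (v x)) x₀ :=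
  ⟨fun x => (trivializationAt F₁ E₁ x₀).symm x (trivializationAt F₁ E₁ x₀ ⟨x₀, v₀⟩).2,
    (trivializationAt F₁ E₁ x₀).symm_proj_apply ⟨x₀, v₀⟩ (mem_baseSet_trivializationAt F₁ E₁ x₀),
    contMDiffAt_trivializationAt_symm (mem_baseSet_trivializationAt F₁ E₁ x₀) _⟩

/-- In trivializations this is the fact that invertible operators are open and that inversion is
smooth on them. -/
theorem ContMDiffAt.hom_inverse [CompleteSpace F₁]
    [∀ x, IsTopologicalAddGroup (E₁ x)] [∀ x, ContinuousSMul ℝ (E₁ x)]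
    {φ : ∀ x, E₁ x →L[ℝ] E₂ x} {x₀ : M}
    (h : ContMDiffAt 𝓘(ℝ, E) (𝓘(ℝ, E).prod 𝓘(ℝ, F₁ →L[ℝ] F₂)) ∞
      (fun x => TotalSpace.mk' (F₁ →L[ℝ] F₂) (E := fun x => E₁ x →L[ℝ] E₂ x) x (φ x)) x₀)
    (h₀ : (φ x₀).IsInvertible) :
    (∀ᶠ x in 𝓝 x₀, (φ x).IsInvertible) ∧
    ContMDiffAt 𝓘(ℝ, E) (𝓘(ℝ, E).prod 𝓘(ℝ, F₂ →L[ℝ] F₁)) ∞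
      (fun x => TotalSpace.mk' (F₂ →L[ℝ] F₁) (E := fun x => E₂ x →L[ℝ] E₁ x) x (φ x).inverse)
      x₀ := by
  rw [contMDiffAt_hom_bundle] at h ⊢
  have hb₁ := (trivializationAt F₁ E₁ x₀).open_baseSet.mem_nhds
    (mem_baseSet_trivializationAt F₁ E₁ x₀)
  have hb₂ := (trivializationAt F₂ E₂ x₀).open_baseSet.mem_nhds
    (mem_baseSet_trivializationAt F₂ E₂ x₀)
  set A := fun x => inCoordinates F₁ E₁ F₂ E₂ x₀ x x₀ x (φ x) with hA
  have hAc : ContMDiffAt 𝓘(ℝ, E) 𝓘(ℝ, F₁ →L[ℝ] F₂) ∞ A x₀ := h.2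
  have hAi : ∀ᶠ x in 𝓝 x₀, (A x).IsInvertible ↔ (φ x).IsInvertible := by
    filter_upwards [hb₁, hb₂] with x hx hx'
    simp only [hA]
    rw [inCoordinates_eq hx hx']
    simp
  have hAx : (A x₀).IsInvertible := hAi.self_of_nhds.2 h₀
  refine ⟨?_, contMDiffAt_id, ?_⟩
  · have : ∀ᶠ x in 𝓝 x₀, (A x).IsInvertible := by
      obtain ⟨e, he⟩ := hAx
      have := ContinuousLinearEquiv.nhds e
      rw [he] at this
      filter_upwards [hAc.continuousAt this] with x hx
      obtain ⟨e', he'⟩ := hx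
      exact ⟨e', he'⟩
    filter_upwards [this, hAi] with x hx hx'
    exact hx'.1 hx
  · refine (ContMDiffAt.comp x₀ hAx.contDiffAt_map_inverse.contMDiffAt hAc).congr_of_eventuallyEq ?_
    filter_upwards [hb₁, hb₂] with x hx hx'
    simp only [hA, Function.comp_apply]
    rw [inCoordinates_eq hx hx', inCoordinates_eq hx' hx]
    simp [ContinuousLinearMap.comp_assoc]

end HomBundle

/-! ### Local right inverses of surjective bundle maps. -/

section RightInverse

open Filter Topology ContinuousLinearMap

variable {E : Type*} [NormedAddCommGroup E] [NormedSpace ℝ E]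
  {M : Type*} [TopologicalSpace M] [ChartedSpace E M]
  {F₁ : Type*} [NormedAddCommGroup F₁] [NormedSpace ℝ F₁]
  {F₂ : Type*} [NormedAddCommGroup F₂] [NormedSpace ℝ F₂]
  {F₃ : Type*} [NormedAddCommGroup F₃] [NormedSpace ℝ F₃]
  {E₁ : M → Type*} [TopologicalSpace (TotalSpace F₁ E₁)]
  [∀ x, AddCommGroup (E₁ x)] [∀ x, Module ℝ (E₁ x)] [∀ x, TopologicalSpace (E₁ x)]
  [FiberBundle F₁ E₁] [VectorBundle ℝ F₁ E₁]
  {E₂ : M → Type*} [TopologicalSpace (TotalSpace F₂ E₂)]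
  [∀ x, AddCommGroup (E₂ x)] [∀ x, Module ℝ (E₂ x)] [∀ x, TopologicalSpace (E₂ x)]
  [∀ x, IsTopologicalAddGroup (E₂ x)] [∀ x, ContinuousSMul ℝ (E₂ x)]
  [FiberBundle F₂ E₂] [VectorBundle ℝ F₂ E₂]
  {E₃ : M → Type*} [TopologicalSpace (TotalSpace F₃ E₃)]
  [∀ x, AddCommGroup (E₃ x)] [∀ x, Module ℝ (E₃ x)] [∀ x, TopologicalSpace (E₃ x)]
  [∀ x, IsTopologicalAddGroup (E₃ x)] [∀ x, ContinuousSMul ℝ (E₃ x)]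
  [FiberBundle F₃ E₃] [VectorBundle ℝ F₃ E₃]

theorem ContMDiffAt.hom_comp [FiniteDimensional ℝ F₁] [ContMDiffVectorBundle ∞ F₁ E₁ 𝓘(ℝ, E)]
    {ψ : ∀ x, E₂ x →L[ℝ] E₃ x} {φ : ∀ x, E₁ x →L[ℝ] E₂ x} {x₀ : M}
    (hψ : ContMDiffAt 𝓘(ℝ, E) (𝓘(ℝ, E).prod 𝓘(ℝ, F₂ →L[ℝ] F₃)) ∞
      (fun x => TotalSpace.mk' (F₂ →L[ℝ] F₃) (E := fun x => E₂ x →L[ℝ] E₃ x) x (ψ x)) x₀)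
    (hφ : ContMDiffAt 𝓘(ℝ, E) (𝓘(ℝ, E).prod 𝓘(ℝ, F₁ →L[ℝ] F₂)) ∞
      (fun x => TotalSpace.mk' (F₁ →L[ℝ] F₂) (E := fun x => E₁ x →L[ℝ] E₂ x) x (φ x)) x₀) :
    ContMDiffAt 𝓘(ℝ, E) (𝓘(ℝ, E).prod 𝓘(ℝ, F₁ →L[ℝ] F₃)) ∞
      (fun x => TotalSpace.mk' (F₁ →L[ℝ] F₃) (E := fun x => E₁ x →L[ℝ] E₃ x) x
        (ψ x ∘L φ x)) x₀ :=
  contMDiffAt_hom_of_apply fun y => hψ.clm_bundle_apply (hφ.clm_bundle_apply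
    (contMDiffAt_trivializationAt_symm (mem_baseSet_trivializationAt F₁ E₁ x₀) y))

/-- A smooth bundle map that is surjective at a point has a smooth right inverse near it. -/
theorem exists_local_rightInverse [FiniteDimensional ℝ F₁] [FiniteDimensional ℝ F₂]
    [∀ x, IsTopologicalAddGroup (E₁ x)] [∀ x, ContinuousSMul ℝ (E₁ x)]
    [ContMDiffVectorBundle ∞ F₁ E₁ 𝓘(ℝ, E)] [ContMDiffVectorBundle ∞ F₂ E₂ 𝓘(ℝ, E)]
    {φ : ∀ x, E₁ x →L[ℝ] E₂ x}
    (h : ContMDiff 𝓘(ℝ, E) (𝓘(ℝ, E).prod 𝓘(ℝ, F₁ →L[ℝ] F₂)) ∞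
      (fun x => TotalSpace.mk' (F₁ →L[ℝ] F₂) (E := fun x => E₁ x →L[ℝ] E₂ x) x (φ x)))
    (x₀ : M) (h₀ : Function.Surjective (φ x₀)) :
    ∃ r : ∀ x, E₂ x →L[ℝ] E₁ x, ∀ᶠ x in 𝓝 x₀,
      ContMDiffAt 𝓘(ℝ, E) (𝓘(ℝ, E).prod 𝓘(ℝ, F₂ →L[ℝ] F₁)) ∞
        (fun x => TotalSpace.mk' (F₂ →L[ℝ] F₁) (E := fun x => E₂ x →L[ℝ] E₁ x) x (r x)) x ∧
      ∀ w, φ x (r x w) = w := by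
  set e₁ := trivializationAt F₁ E₁ x₀
  set e₂ := trivializationAt F₂ E₂ x₀
  have hx₁ : x₀ ∈ e₁.baseSet := mem_baseSet_trivializationAt F₁ E₁ x₀
  have hx₂ : x₀ ∈ e₂.baseSet := mem_baseSet_trivializationAt F₂ E₂ x₀
  obtain ⟨ρ₀, hρ₀⟩ := (φ x₀ : E₁ x₀ →ₗ[ℝ] E₂ x₀).exists_rightInverse_of_surjective
    (LinearMap.range_eq_top.2 h₀)
  -- A right inverse at `x₀`, read in the trivializations and extended as a constant map. The
  -- resulting `c` is an exact right inverse only at `x₀`.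
  let ρ : F₂ →L[ℝ] F₁ := LinearMap.toContinuousLinearMap
    ((e₁.continuousLinearMapAt ℝ x₀ : E₁ x₀ →ₗ[ℝ] F₁) ∘ₗ ρ₀ ∘ₗ (e₂.symmL ℝ x₀ : F₂ →ₗ[ℝ] E₂ x₀))
  let c : ∀ x, E₂ x →L[ℝ] E₁ x := fun x =>
    e₁.symmL ℝ x ∘L ρ ∘L e₂.continuousLinearMapAt ℝ x
  have hc : ∀ x ∈ e₁.baseSet, x ∈ e₂.baseSet →
      ContMDiffAt 𝓘(ℝ, E) (𝓘(ℝ, E).prod 𝓘(ℝ, F₂ →L[ℝ] F₁)) ∞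
        (fun x => TotalSpace.mk' (F₂ →L[ℝ] F₁) (E := fun x => E₂ x →L[ℝ] E₁ x) x (c x)) x := by
    intro x h1 h2
    refine contMDiffAt_hom_of_apply fun y => ?_
    rw [e₁.contMDiffAt_section_iff h1]
    have h3 := (e₂.contMDiffAt_section_iff (IB := 𝓘(ℝ, E)) (n := ∞) h2).1 (contMDiffAt_trivializationAt_symm
      (F₁ := F₂) (E₁ := E₂) (mem_baseSet_trivializationAt F₂ E₂ x) y)
    refine (ρ.contDiff.contMDiff.contMDiffAt.comp x h3).congr_of_eventuallyEq ?_
    filter_upwards [e₁.open_baseSet.mem_nhds h1, e₂.open_baseSet.mem_nhds h2] with z hz1 hz2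
    simp [c, hz1, hz2, e₁.apply_mk_symm hz1, Bundle.Trivialization.coe_linearMapAt_of_mem]
  have hi : φ x₀ ∘L c x₀ = .id ℝ (E₂ x₀) := by
    ext w
    have := LinearMap.congr_fun hρ₀ w
    simpa [c, ρ, hx₁, hx₂] using this
  obtain ⟨hev, -⟩ := ((h x₀).hom_comp (hc x₀ hx₁ hx₂)).hom_inverse
    (by rw [hi]; exact ⟨.refl ℝ _, rfl⟩)
  -- Since φ ∘ c is the identity at `x₀`, it stays invertible nearby, and composing `c` with its
  -- inverse corrects the error.
  refine ⟨fun x => c x ∘L (φ x ∘L c x).inverse, ?_⟩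
  filter_upwards [hev, e₁.open_baseSet.mem_nhds hx₁, e₂.open_baseSet.mem_nhds hx₂]
    with x hx h1 h2
  exact ⟨(hc x h1 h2).hom_comp (((h x).hom_comp (hc x h1 h2)).hom_inverse hx).2,
    fun w => hx.self_apply_inverse w⟩

end RightInverse

/-! ### Gluing by partitions of unity. -/

section ConvexHom

open Topology Filter
variable {E : Type*} [NormedAddCommGroup E] [NormedSpace ℝ E] [FiniteDimensional ℝ E]
  {M : Type*} [TopologicalSpace M] [ChartedSpace E M] [IsManifold 𝓘(ℝ, E) ∞ M]
  {F₁ : Type*} [NormedAddCommGroup F₁] [NormedSpace ℝ F₁]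
  {F₂ : Type*} [NormedAddCommGroup F₂] [NormedSpace ℝ F₂]
  {E₁ : M → Type*} [TopologicalSpace (TotalSpace F₁ E₁)]
  [∀ x, AddCommGroup (E₁ x)] [∀ x, Module ℝ (E₁ x)] [∀ x, TopologicalSpace (E₁ x)]
  [FiberBundle F₁ E₁] [VectorBundle ℝ F₁ E₁]
  {E₂ : M → Type*} [TopologicalSpace (TotalSpace F₂ E₂)]
  [∀ x, AddCommGroup (E₂ x)] [∀ x, Module ℝ (E₂ x)] [∀ x, TopologicalSpace (E₂ x)]
  [∀ x, IsTopologicalAddGroup (E₂ x)] [∀ x, ContinuousSMul ℝ (E₂ x)]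
  [FiberBundle F₂ E₂] [VectorBundle ℝ F₂ E₂]

/-- A version of `exists_contMDiffSection_forall_mem_convex_of_local` for bundles of continuous
linear maps. -/
theorem exists_hom_forall_mem_convex_of_local [T2Space M] [SigmaCompactSpace M]
    (t : ∀ x : M, Set (E₁ x →L[ℝ] E₂ x)) (ht : ∀ x, Convex ℝ (t x))
    (h : ∀ x₀ : M, ∃ U ∈ 𝓝 x₀, ∃ φ : ∀ x, E₁ x →L[ℝ] E₂ x,
      ContMDiffOn 𝓘(ℝ, E) (𝓘(ℝ, E).prod 𝓘(ℝ, F₁ →L[ℝ] F₂)) ∞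
        (fun x => TotalSpace.mk' (F₁ →L[ℝ] F₂) (E := fun x => E₁ x →L[ℝ] E₂ x) x (φ x)) U ∧
      ∀ x ∈ U, φ x ∈ t x) :
    ∃ φ : ∀ x, E₁ x →L[ℝ] E₂ x,
      ContMDiff 𝓘(ℝ, E) (𝓘(ℝ, E).prod 𝓘(ℝ, F₁ →L[ℝ] F₂)) ∞
        (fun x => TotalSpace.mk' (F₁ →L[ℝ] F₂) (E := fun x => E₁ x →L[ℝ] E₂ x) x (φ x)) ∧
      ∀ x, φ x ∈ t x := by
  obtain ⟨φ, hφ⟩ := exists_contMDiffSection_forall_mem_convex_of_local 𝓘(ℝ, E) (n := ⊤)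
    (F_fiber := F₁ →L[ℝ] F₂) (fun x => E₁ x →L[ℝ] E₂ x) t ht h
  exact ⟨φ, φ.contMDiff, hφ⟩

end ConvexHom

/-! ### Bilinear forms on bundles, and the topology of the fibres. -/

section Bilinear

open Filter Topology

variable {E : Type*} [NormedAddCommGroup E] [NormedSpace ℝ E]
  {M : Type*} [TopologicalSpace M] [ChartedSpace E M]
  {F₁ : Type*} [NormedAddCommGroup F₁] [NormedSpace ℝ F₁]
  {F₂ : Type*} [NormedAddCommGroup F₂] [NormedSpace ℝ F₂]
  {E₁ : M → Type*} [TopologicalSpace (TotalSpace F₁ E₁)]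
  [∀ x, AddCommGroup (E₁ x)] [∀ x, Module ℝ (E₁ x)] [∀ x, TopologicalSpace (E₁ x)]
  [FiberBundle F₁ E₁] [VectorBundle ℝ F₁ E₁]
  {E₂ : M → Type*} [TopologicalSpace (TotalSpace F₂ E₂)]
  [∀ x, AddCommGroup (E₂ x)] [∀ x, Module ℝ (E₂ x)] [∀ x, TopologicalSpace (E₂ x)]
  [FiberBundle F₂ E₂] [VectorBundle ℝ F₂ E₂]

theorem contMDiffAt_section_trivial_iff {E₀ : Type*} [NormedAddCommGroup E₀]
    [NormedSpace ℝ E₀] {H₀ : Type*} [TopologicalSpace H₀] {I₀ : ModelWithCorners ℝ E₀ H₀}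
    {N : Type*} [TopologicalSpace N] [ChartedSpace H₀ N] {b : N → M} {f : N → ℝ}
    {p : N} (hb : ContMDiffAt I₀ 𝓘(ℝ, E) ∞ b p) :
    ContMDiffAt I₀ (𝓘(ℝ, E).prod 𝓘(ℝ, ℝ)) ∞
      (fun x => TotalSpace.mk' ℝ (E := Bundle.Trivial M ℝ) (b x) (f x)) p ↔
    ContMDiffAt I₀ 𝓘(ℝ, ℝ) ∞ f p := by
  rw [contMDiffAt_totalSpace]
  exact ⟨fun h => h.2, fun h => ⟨hb, h⟩⟩

theorem contMDiffAt_bilin_of_apply [FiniteDimensional ℝ F₁] [FiniteDimensional ℝ F₂]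
    {R : ∀ x, E₁ x →L[ℝ] E₂ x →L[ℝ] ℝ} {x₀ : M}
    (h : ∀ y z, ContMDiffAt 𝓘(ℝ, E) 𝓘(ℝ, ℝ) ∞ (fun x => R x
      ((trivializationAt F₁ E₁ x₀).symm x y) ((trivializationAt F₂ E₂ x₀).symm x z)) x₀) :
    ContMDiffAt 𝓘(ℝ, E) (𝓘(ℝ, E).prod 𝓘(ℝ, F₁ →L[ℝ] F₂ →L[ℝ] ℝ)) ∞
      (fun x => TotalSpace.mk' (F₁ →L[ℝ] F₂ →L[ℝ] ℝ)
        (E := fun x => E₁ x →L[ℝ] E₂ x →L[ℝ] ℝ) x (R x)) x₀ :=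
  contMDiffAt_hom_of_apply fun y => contMDiffAt_hom_of_apply fun z =>
    (contMDiffAt_section_trivial_iff contMDiffAt_id).2 (h y z)

include F₁ in
theorem t2Space_fibre (x : M) : T2Space (E₁ x) :=
  ((trivializationAt F₁ E₁ x).continuousLinearEquivAt ℝ x
    (mem_baseSet_trivializationAt F₁ E₁ x)).toHomeomorph.symm.t2Space

include F₁ in
theorem finiteDimensional_fibre [FiniteDimensional ℝ F₁] (x : M) : FiniteDimensional ℝ (E₁ x) :=
  ((trivializationAt F₁ E₁ x).continuousLinearEquivAt ℝ x
    (mem_baseSet_trivializationAt F₁ E₁ x)).toLinearEquiv.symm.finiteDimensional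

end Bilinear

/-! ### Splitting forms and their existence. -/

namespace CourantGeometry

section Splitting

open Filter Topology

variable {E : Type*} [NormedAddCommGroup E] [NormedSpace ℝ E]
  {M : Type*} [TopologicalSpace M] [ChartedSpace E M] [IsManifold 𝓘(ℝ, E) ∞ M]
  {F : Type*} [NormedAddCommGroup F] [NormedSpace ℝ F]
  {V : M → Type*} [TopologicalSpace (TotalSpace F V)]
  [∀ x, AddCommGroup (V x)] [∀ x, Module ℝ (V x)] [∀ x, TopologicalSpace (V x)]
  [∀ x, IsTopologicalAddGroup (V x)] [∀ x, ContinuousSMul ℝ (V x)]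
  [FiberBundle F V] [VectorBundle ℝ F V]

/-- The condition on a bilinear form `R` on `T_x M × V_x` that makes `s`, determined by
`⟨s X, w⟩ = R X w`, an isotropic splitting at `x`. -/
def CourantAlgebroid.IsSplittingForm (A : CourantAlgebroid E F V) (x : M)
    (R : TangentSpace 𝓘(ℝ, E) x →L[ℝ] V x →L[ℝ] ℝ) : Prop :=
  ∀ v w : V x, R (A.anchor x v) w + R (A.anchor x w) v = A.pairing x v w

/-- The left side of the condition is linear in R and the right side does not involve R. -/
theorem CourantAlgebroid.convex_isSplittingForm (A : CourantAlgebroid E F V) (x : M) :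
    Convex ℝ {R | A.IsSplittingForm x R} := by
  intro R hR S hS a b _ _ hab v w
  have h1 := hR v w
  have h2 := hS v w
  simp only [add_apply, smul_apply, smul_eq_mul]
  linear_combination a * h1 + b * h2 + A.pairing x v w * hab

variable (A : ExtendedTangentBundle E F V)

namespace ExtendedTangentBundle

/-- By exactness v = a*ξ, and 2⟨a*ξ, w⟩ = ξ(a w). -/
theorem pairing_eq_zero_of_anchor_eq_zero {x : M} {v w : V x} (hv : A.anchor x v = 0)
    (hw : A.anchor x w = 0) : A.pairing x v w = 0 := by
  obtain ⟨ξ, rfl⟩ := (A.exact x v).1 hv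
  have h := A.two_pairing_coanchor x ξ w
  rw [hw, map_zero] at h
  linarith

variable [FiniteDimensional ℝ E] [FiniteDimensional ℝ F] [ContMDiffVectorBundle ∞ F V 𝓘(ℝ, E)]

theorem exists_local_isSplittingForm (x₀ : M) :
    ∃ U ∈ 𝓝 x₀, ∃ R : ∀ x, TangentSpace 𝓘(ℝ, E) x →L[ℝ] V x →L[ℝ] ℝ,
      ContMDiffOn 𝓘(ℝ, E) (𝓘(ℝ, E).prod 𝓘(ℝ, E →L[ℝ] F →L[ℝ] ℝ)) ∞
        (fun x => TotalSpace.mk' (E →L[ℝ] F →L[ℝ] ℝ)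
          (E := fun x : M => TangentSpace 𝓘(ℝ, E) x →L[ℝ] V x →L[ℝ] ℝ) x (R x)) U ∧
      ∀ x ∈ U, A.IsSplittingForm x (R x) := by
  have (x : M) : T2Space (V x) := t2Space_fibre (F₁ := F) x
  have (x : M) : FiniteDimensional ℝ (V x) := finiteDimensional_fibre (F₁ := F) x
  have (x : M) : T2Space (TangentSpace 𝓘(ℝ, E) x) := inferInstanceAs (T2Space E)
  have (x : M) : FiniteDimensional ℝ (TangentSpace 𝓘(ℝ, E) x) :=
    inferInstanceAs (FiniteDimensional ℝ E)
  obtain ⟨r, hr⟩ := exists_local_rightInverse A.anchor_smooth x₀ (A.anchor_surjective x₀)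
  -- The first term is the form of the possibly non-isotropic splitting `r`; subtracting half of ⟨r
  -- X, r a w⟩ makes the image isotropic.
  refine ⟨_, hr, fun x => LinearMap.toContinuousBilinearMap (LinearMap.mk₂ ℝ
    (fun X w => A.pairing x (r x X) w - 2⁻¹ * A.pairing x (r x X) (r x (A.anchor x w)))
    (fun X Y w => by simp; ring) (fun c X w => by simp; ring)
    (fun X v w => by simp; ring) (fun c X w => by simp; ring)), fun x hx => ?_, fun x hx => ?_⟩
  · refine (contMDiffAt_bilin_of_apply fun y z => ?_).contMDiffWithinAt
    have h1 := contMDiffAt_trivializationAt_symm (E := E) (F₁ := E)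
      (E₁ := fun x : M => TangentSpace 𝓘(ℝ, E) x) (mem_baseSet_trivializationAt E _ x) y
    have h2 := contMDiffAt_trivializationAt_symm (E := E) (F₁ := F) (E₁ := V)
      (mem_baseSet_trivializationAt F V x) z
    have h3 := hx.1.clm_bundle_apply h1
    have h4 := hx.1.clm_bundle_apply ((A.anchor_smooth x).clm_bundle_apply h2)
    have h5 := (contMDiffAt_section_trivial_iff contMDiffAt_id).1
      ((A.pairing_smooth x).clm_bundle_apply₂ h3 h2)
    have h6 := (contMDiffAt_section_trivial_iff contMDiffAt_id).1
      ((A.pairing_smooth x).clm_bundle_apply₂ h3 h4)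
    exact h5.sub (contMDiffAt_const.mul h6)
  · intro v w
    -- Both v − r a v and w − r a w lie in the isotropic kernel of the anchor; expanding their
    -- pairing gives the identity.
    have h := A.pairing_eq_zero_of_anchor_eq_zero (x := x)
      (v := v - r x (A.anchor x v)) (w := w - r x (A.anchor x w))
      (by rw [map_sub, hx.2, sub_self]) (by rw [map_sub, hx.2, sub_self])
    simp only [map_sub, sub_apply] at h
    have h1 := A.pairing_symm x v (r x (A.anchor x w))
    have h2 := A.pairing_symm x (r x (A.anchor x w)) (r x (A.anchor x v))
    simp only [LinearMap.toContinuousBilinearMap_apply, LinearMap.mk₂_apply]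
    linarith

theorem exists_isSplittingForm [T2Space M] [SigmaCompactSpace M] :
    ∃ R : ∀ x, TangentSpace 𝓘(ℝ, E) x →L[ℝ] V x →L[ℝ] ℝ,
      ContMDiff 𝓘(ℝ, E) (𝓘(ℝ, E).prod 𝓘(ℝ, E →L[ℝ] F →L[ℝ] ℝ)) ∞
        (fun x => TotalSpace.mk' (E →L[ℝ] F →L[ℝ] ℝ)
          (E := fun x : M => TangentSpace 𝓘(ℝ, E) x →L[ℝ] V x →L[ℝ] ℝ) x (R x)) ∧
      ∀ x, A.IsSplittingForm x (R x) :=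
  exists_hom_forall_mem_convex_of_local (E₁ := fun x : M => TangentSpace 𝓘(ℝ, E) x)
    (E₂ := fun x => V x →L[ℝ] ℝ) (F₁ := E) (F₂ := F →L[ℝ] ℝ)
    (fun x => {R | A.IsSplittingForm x R}) (fun x => A.convex_isSplittingForm x)
    A.exists_local_isSplittingForm

end ExtendedTangentBundle

end Splitting

end CourantGeometry

/-! ### Averaging a splitting form over the group. -/

namespace CourantGeometry

section Averaging

open Filter Topology MeasureTheory

variable {E : Type*} [NormedAddCommGroup E] [NormedSpace ℝ E]
  {M : Type*} [TopologicalSpace M] [ChartedSpace E M] [IsManifold 𝓘(ℝ, E) ∞ M]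
  {F : Type*} [NormedAddCommGroup F] [NormedSpace ℝ F]
  {V : M → Type*} [TopologicalSpace (TotalSpace F V)]
  [∀ x, AddCommGroup (V x)] [∀ x, Module ℝ (V x)] [∀ x, TopologicalSpace (V x)]
  [∀ x, IsTopologicalAddGroup (V x)] [∀ x, ContinuousSMul ℝ (V x)]
  [FiberBundle F V] [VectorBundle ℝ F V]

theorem BundleAut.fibre_mul (φ ψ : BundleAut E F V) (x : M) (v : V x) :
    (φ * ψ).fibre x v = φ.fibre (ψ.base x) (ψ.fibre x v) := by
  have h := (φ * ψ).total_mk x v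
  rw [BundleAut.mul_total, ψ.total_mk, φ.total_mk] at h
  exact (TotalSpace.mk_injective _ h).symm

theorem BundleAut.fibre_surjective (φ : BundleAut E F V) (x : M) :
    Function.Surjective (φ.fibre x) := by
  intro w
  obtain ⟨⟨z, v⟩, hp⟩ := EquivLike.surjective φ.total ⟨φ.base x, w⟩
  rw [φ.total_mk] at hp
  obtain rfl : z = x := φ.base.injective (congrArg TotalSpace.proj hp)
  exact ⟨v, TotalSpace.mk_injective _ hp⟩

theorem IsCourantSymmetry.anchor_fibre {A : CourantAlgebroid E F V} {φ : BundleAut E F V}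
    (h : IsCourantSymmetry A φ) (x : M) (v : V x) :
    A.anchor (φ.base x) (φ.fibre x v) = mfderiv 𝓘(ℝ, E) 𝓘(ℝ, E) φ.base x (A.anchor x v) := by
  have h := h.anchor ⟨x, v⟩
  rw [φ.total_mk] at h
  exact TotalSpace.mk_injective _ h

variable {E' : Type*} [NormedAddCommGroup E'] [NormedSpace ℝ E']
  {G : Type*} [Group G] [TopologicalSpace G] [ChartedSpace E' G]
  {A : ExtendedTangentBundle E F V} (σ : LieGroupAction E' G A)

namespace LieGroupAction

/-- The bundle automorphism by which a group element acts. -/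
noncomputable abbrev aut (g : G) : BundleAut E F V := (σ.hom g : BundleAut E F V)

theorem isCourantSymmetry_aut (g : G) : IsCourantSymmetry A.toCourantAlgebroid (σ.aut g) :=
  (σ.hom g).2

theorem aut_mul (g h : G) : σ.aut (g * h) = σ.aut g * σ.aut h := by
  simp [aut, map_mul]

/-- The pull-back along `g⁻¹` of a bilinear form on `TM × V`. -/
noncomputable def pullbackForm (R : ∀ x, TangentSpace 𝓘(ℝ, E) x →L[ℝ] V x →L[ℝ] ℝ) (g : G) (x : M)
    (X : TangentSpace 𝓘(ℝ, E) x) (w : V x) : ℝ :=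
  R ((σ.aut g⁻¹).base x) (mfderiv 𝓘(ℝ, E) 𝓘(ℝ, E) (σ.aut g⁻¹).base x X) ((σ.aut g⁻¹).fibre x w)

variable {R : ∀ x, TangentSpace 𝓘(ℝ, E) x →L[ℝ] V x →L[ℝ] ℝ}

/-- On tangent vectors of the form a(v), equivariance of the anchor trades the differential of the
base map for the action on V, which is smooth jointly in g and the vector. -/
theorem pullbackForm_anchor (g : G) (x : M) (v w : V x) :
    σ.pullbackForm R g x (A.anchor x v) w = R ((σ.aut g⁻¹).base x)
      (A.anchor _ ((σ.aut g⁻¹).fibre x v)) ((σ.aut g⁻¹).fibre x w) := by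
  rw [(σ.isCourantSymmetry_aut g⁻¹).anchor_fibre]
  rfl

/-- Moving the arguments by h amounts to a left translation of the group variable, which Haar
measure does not see. -/
theorem pullbackForm_base (g h : G) (x : M) (v w : V x) :
    σ.pullbackForm R g ((σ.aut h).base x) (A.anchor _ ((σ.aut h).fibre x v))
      ((σ.aut h).fibre x w) = σ.pullbackForm R (h⁻¹ * g) x (A.anchor x v) w := by
  rw [pullbackForm_anchor, pullbackForm_anchor,
    show (h⁻¹ * g)⁻¹ = g⁻¹ * h by simp, aut_mul, BundleAut.fibre_mul, BundleAut.fibre_mul]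
  rfl

/-- The action map is composed with inversion in G and the section. Projecting to M also yields
joint smoothness of the base action. -/
theorem contMDiffAt_fibre [LieGroup 𝓘(ℝ, E') ∞ G] {v : ∀ x, V x} {x₀ : M}
    (hv : ContMDiffAt 𝓘(ℝ, E) (𝓘(ℝ, E).prod 𝓘(ℝ, F)) ∞ (fun x => TotalSpace.mk' F x (v x)) x₀)
    (g : G) :
    ContMDiffAt (𝓘(ℝ, E').prod 𝓘(ℝ, E)) (𝓘(ℝ, E).prod 𝓘(ℝ, F)) ∞
      (fun p : G × M => TotalSpace.mk' F ((σ.aut p.1⁻¹).base p.2)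
        ((σ.aut p.1⁻¹).fibre p.2 (v p.2))) (g, x₀) := by
  have h1 : ContMDiffAt (𝓘(ℝ, E').prod 𝓘(ℝ, E)) (𝓘(ℝ, E').prod (𝓘(ℝ, E).prod 𝓘(ℝ, F))) ∞
      (fun p : G × M => (p.1⁻¹, TotalSpace.mk' F p.2 (v p.2))) (g, x₀) :=
    (contMDiffAt_fst.inv).prodMk (ContMDiffAt.comp (g, x₀) hv contMDiffAt_snd)
  refine (σ.smooth.contMDiffAt.comp (g, x₀) h1).congr_of_eventuallyEq (.of_forall fun p => ?_)
  exact ((σ.aut p.1⁻¹).total_mk p.2 (v p.2)).symm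

theorem contMDiffAt_pullbackForm [LieGroup 𝓘(ℝ, E') ∞ G]
    (hR : ContMDiff 𝓘(ℝ, E) (𝓘(ℝ, E).prod 𝓘(ℝ, E →L[ℝ] F →L[ℝ] ℝ)) ∞
      (fun x => TotalSpace.mk' (E →L[ℝ] F →L[ℝ] ℝ)
        (E := fun x : M => TangentSpace 𝓘(ℝ, E) x →L[ℝ] V x →L[ℝ] ℝ) x (R x)))
    {v w : ∀ x, V x} {x₀ : M}
    (hv : ContMDiffAt 𝓘(ℝ, E) (𝓘(ℝ, E).prod 𝓘(ℝ, F)) ∞ (fun x => TotalSpace.mk' F x (v x)) x₀)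
    (hw : ContMDiffAt 𝓘(ℝ, E) (𝓘(ℝ, E).prod 𝓘(ℝ, F)) ∞ (fun x => TotalSpace.mk' F x (w x)) x₀)
    (g : G) :
    ContMDiffAt (𝓘(ℝ, E').prod 𝓘(ℝ, E)) 𝓘(ℝ, ℝ) ∞
      (Function.uncurry fun (g : G) (x : M) =>
        σ.pullbackForm R g x (A.anchor x (v x)) (w x)) (g, x₀) := by
  have h1 := σ.contMDiffAt_fibre hv g
  have h2 := σ.contMDiffAt_fibre hw g
  have hb := (contMDiffAt_totalSpace.1 h1).1
  have h3 := (A.anchor_smooth.contMDiffAt.comp (g, x₀) hb).clm_bundle_apply h1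
  have h4 := (contMDiffAt_section_trivial_iff hb).1
    ((hR.contMDiffAt.comp (g, x₀) hb).clm_bundle_apply₂ h3 h2)
  refine h4.congr_of_eventuallyEq (.of_forall fun p => ?_)
  exact σ.pullbackForm_anchor p.1 p.2 (v p.2) (w p.2)

variable [LieGroup 𝓘(ℝ, E') ∞ G]

theorem continuous_pullbackForm [ContMDiffVectorBundle ∞ F V 𝓘(ℝ, E)]
    (hR : ContMDiff 𝓘(ℝ, E) (𝓘(ℝ, E).prod 𝓘(ℝ, E →L[ℝ] F →L[ℝ] ℝ)) ∞
      (fun x => TotalSpace.mk' (E →L[ℝ] F →L[ℝ] ℝ)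
        (E := fun x : M => TangentSpace 𝓘(ℝ, E) x →L[ℝ] V x →L[ℝ] ℝ) x (R x)))
    (x : M) (X : TangentSpace 𝓘(ℝ, E) x) (w : V x) :
    Continuous fun g => σ.pullbackForm R g x X w := by
  obtain ⟨v, rfl⟩ := A.anchor_surjective x X
  obtain ⟨v', rfl, hv⟩ := exists_section_contMDiffAt (E := E) (F₁ := F) x v
  obtain ⟨w', rfl, hw⟩ := exists_section_contMDiffAt (E := E) (F₁ := F) x w
  exact continuous_iff_continuousAt.2 fun g => ContinuousAt.comp (f := fun g => (g, x))
    (σ.contMDiffAt_pullbackForm hR hv hw g).continuousAt (by fun_prop)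

/-- Averaging over a compact group makes a splitting form invariant. -/
theorem exists_invariant_isSplittingForm [CompactSpace G] [FiniteDimensional ℝ E]
    [FiniteDimensional ℝ F] [ContMDiffVectorBundle ∞ F V 𝓘(ℝ, E)]
    (hR : ContMDiff 𝓘(ℝ, E) (𝓘(ℝ, E).prod 𝓘(ℝ, E →L[ℝ] F →L[ℝ] ℝ)) ∞
      (fun x => TotalSpace.mk' (E →L[ℝ] F →L[ℝ] ℝ)
        (E := fun x : M => TangentSpace 𝓘(ℝ, E) x →L[ℝ] V x →L[ℝ] ℝ) x (R x)))
    (hs : ∀ x, A.IsSplittingForm x (R x)) :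
    ∃ S : ∀ x, TangentSpace 𝓘(ℝ, E) x →L[ℝ] V x →L[ℝ] ℝ,
      ContMDiff 𝓘(ℝ, E) (𝓘(ℝ, E).prod 𝓘(ℝ, E →L[ℝ] F →L[ℝ] ℝ)) ∞
        (fun x => TotalSpace.mk' (E →L[ℝ] F →L[ℝ] ℝ)
          (E := fun x : M => TangentSpace 𝓘(ℝ, E) x →L[ℝ] V x →L[ℝ] ℝ) x (S x)) ∧
      (∀ x, A.IsSplittingForm x (S x)) ∧
      ∀ (h : G) (x : M) (X : TangentSpace 𝓘(ℝ, E) x) (w : V x),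
        S ((σ.aut h).base x) (mfderiv 𝓘(ℝ, E) 𝓘(ℝ, E) (σ.aut h).base x X)
          ((σ.aut h).fibre x w) = S x X w := by
  have (x : M) : T2Space (V x) := t2Space_fibre (F₁ := F) x
  have (x : M) : FiniteDimensional ℝ (V x) := finiteDimensional_fibre (F₁ := F) x
  have (x : M) : T2Space (TangentSpace 𝓘(ℝ, E) x) := inferInstanceAs (T2Space E)
  have (x : M) : FiniteDimensional ℝ (TangentSpace 𝓘(ℝ, E) x) :=
    inferInstanceAs (FiniteDimensional ℝ E)
  have : IsTopologicalGroup G := topologicalGroup_of_lieGroup 𝓘(ℝ, E') ∞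
  let _ : MeasurableSpace G := borel G
  have : BorelSpace G := ⟨rfl⟩
  -- Normalised to give the whole group mass 1, so that averaging preserves the inhomogeneous term
  -- ⟨v, w⟩.
  let μ : Measure G := Measure.haarMeasure ⊤
  have : IsProbabilityMeasure μ := ⟨by
    simpa using Measure.haarMeasure_self (K₀ := (⊤ : TopologicalSpace.PositiveCompacts G))⟩
  have hi : ∀ (x : M) (X : TangentSpace 𝓘(ℝ, E) x) (w : V x),
      Integrable (fun g => σ.pullbackForm R g x X w) μ := fun x X w =>
    (σ.continuous_pullbackForm hR x X w).integrable_of_compactSpace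
  refine ⟨fun x => LinearMap.toContinuousBilinearMap (LinearMap.mk₂ ℝ
    (fun X w => ∫ g, σ.pullbackForm R g x X w ∂μ)
    (fun X Y w => by
      rw [← integral_add (hi x X w) (hi x Y w)]
      simp [pullbackForm])
    (fun c X w => by
      rw [smul_eq_mul, ← integral_const_mul]
      simp [pullbackForm])
    (fun X v w => by
      rw [← integral_add (hi x X v) (hi x X w)]
      simp [pullbackForm])
    (fun c X w => by
      rw [smul_eq_mul, ← integral_const_mul]
      simp [pullbackForm])), fun x₀ => ?_, fun x v w => ?_, fun h x X w => ?_⟩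
  · refine contMDiffAt_bilin_of_apply fun y z => ?_
    -- A local right inverse of the anchor lifts tangent fields near `x₀` to smooth sections of V,
    -- as `contMDiffAt_pullbackForm` requires.
    obtain ⟨r, hr⟩ := exists_local_rightInverse A.anchor_smooth x₀ (A.anchor_surjective x₀)
    have hT := (trivializationAt E (fun x : M => TangentSpace 𝓘(ℝ, E) x) x₀).open_baseSet.mem_nhds
      (mem_baseSet_trivializationAt E _ x₀)
    have hV := (trivializationAt F V x₀).open_baseSet.mem_nhds
      (mem_baseSet_trivializationAt F V x₀)
    have h1 := contMDiffAt_integral (E' := E') (μ := μ) (x₀ := x₀) (f := fun g x =>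
      σ.pullbackForm R g x (A.anchor x (r x
        ((trivializationAt E (fun x : M => TangentSpace 𝓘(ℝ, E) x) x₀).symm x y)))
        ((trivializationAt F V x₀).symm x z)) (by
      filter_upwards [hr, hT, hV] with x hx hxT hxV g
      exact σ.contMDiffAt_pullbackForm hR
        (hx.1.clm_bundle_apply (contMDiffAt_trivializationAt_symm (E := E) hxT y))
        (contMDiffAt_trivializationAt_symm hxV z) g)
    refine h1.congr_of_eventuallyEq ?_
    filter_upwards [hr] with x hx
    simp only [hx.2]
    rfl
  · simp only [LinearMap.toContinuousBilinearMap_apply, LinearMap.mk₂_apply]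
    rw [← integral_add (hi x _ _) (hi x _ _)]
    -- Each pull-back is itself a splitting form, because symmetries preserve the pairing.
    have : ∀ g : G, σ.pullbackForm R g x (A.anchor x v) w +
        σ.pullbackForm R g x (A.anchor x w) v = A.pairing x v w := fun g => by
      rw [pullbackForm_anchor, pullbackForm_anchor, hs]
      exact (σ.isCourantSymmetry_aut g⁻¹).pairing x v w
    simp [this]
  · obtain ⟨v, rfl⟩ := A.anchor_surjective x X
    rw [← (σ.isCourantSymmetry_aut h).anchor_fibre]
    simp only [LinearMap.toContinuousBilinearMap_apply, LinearMap.mk₂_apply, pullbackForm_base]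
    exact integral_mul_left_eq_self (fun g => σ.pullbackForm R g x (A.anchor x v) w) h⁻¹

end LieGroupAction

end Averaging

end CourantGeometry

/-! ### From invariant splitting forms back to preserved splittings. -/

namespace CourantGeometry

section SplittingOfForm

open Filter Topology

variable {E : Type*} [NormedAddCommGroup E] [NormedSpace ℝ E]
  {M : Type*} [TopologicalSpace M] [ChartedSpace E M] [IsManifold 𝓘(ℝ, E) ∞ M]
  {F : Type*} [NormedAddCommGroup F] [NormedSpace ℝ F] [FiniteDimensional ℝ F]
  {V : M → Type*} [TopologicalSpace (TotalSpace F V)]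
  [∀ x, AddCommGroup (V x)] [∀ x, Module ℝ (V x)] [∀ x, TopologicalSpace (V x)]
  [∀ x, IsTopologicalAddGroup (V x)] [∀ x, ContinuousSMul ℝ (V x)]
  [FiberBundle F V] [VectorBundle ℝ F V]

/-- Non-degeneracy is injectivity of V → V*, and the two fibres have the same finite dimension. -/
theorem CourantAlgebroid.isInvertible_pairing (A : CourantAlgebroid E F V) (x : M) :
    (A.pairing x).IsInvertible := by
  have : T2Space (V x) := t2Space_fibre (F₁ := F) x
  have : FiniteDimensional ℝ (V x) := finiteDimensional_fibre (F₁ := F) x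
  let e : (V x →ₗ[ℝ] ℝ) ≃ₗ[ℝ] (V x →L[ℝ] ℝ) := LinearMap.toContinuousLinearMap
  have : FiniteDimensional ℝ (V x →L[ℝ] ℝ) := e.finiteDimensional
  have hinj : Function.Injective (A.pairing x : V x →ₗ[ℝ] V x →L[ℝ] ℝ) := by
    rw [injective_iff_map_eq_zero]
    exact fun v hv => A.pairing_nondegenerate x v fun w => DFunLike.congr_fun hv w
  have hrank : Module.finrank ℝ (V x) = Module.finrank ℝ (V x →L[ℝ] ℝ) := by
    rw [← e.finrank_eq]
    exact Subspace.dual_finrank_eq.symm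
  exact ⟨(LinearEquiv.ofBijective _ ⟨hinj,
    (LinearMap.injective_iff_surjective_of_finrank_eq_finrank hrank).1 hinj⟩).toContinuousLinearEquiv,
    rfl⟩

/-- The isotropic splitting `s` with `⟨s X, w⟩ = S X w` for a splitting form `S`. -/
theorem ExtendedTangentBundle.exists_isotropicSplitting_of_form [FiniteDimensional ℝ E]
    (A : ExtendedTangentBundle E F V)
    [ContMDiffVectorBundle ∞ F V 𝓘(ℝ, E)]
    {S : ∀ x, TangentSpace 𝓘(ℝ, E) x →L[ℝ] V x →L[ℝ] ℝ}
    (hS : ContMDiff 𝓘(ℝ, E) (𝓘(ℝ, E).prod 𝓘(ℝ, E →L[ℝ] F →L[ℝ] ℝ)) ∞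
      (fun x => TotalSpace.mk' (E →L[ℝ] F →L[ℝ] ℝ)
        (E := fun x : M => TangentSpace 𝓘(ℝ, E) x →L[ℝ] V x →L[ℝ] ℝ) x (S x)))
    (hs : ∀ x, A.IsSplittingForm x (S x)) :
    ∃ s : IsotropicSplitting A, ∀ (x : M) (X : TangentSpace 𝓘(ℝ, E) x) (w : V x),
      A.pairing x (s.toFun x X) w = S x X w := by
  let s : ∀ x : M, TangentSpace 𝓘(ℝ, E) x →L[ℝ] V x := fun x => (A.pairing x).inverse ∘L S x
  have hps : ∀ (x : M) (X : TangentSpace 𝓘(ℝ, E) x) (w : V x),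
      A.pairing x (s x X) w = S x X w := fun x X w =>
    DFunLike.congr_fun ((A.isInvertible_pairing x).self_apply_inverse (S x X)) w
  have hsa : ∀ (x : M) (X : TangentSpace 𝓘(ℝ, E) x), A.anchor x (s x X) = X := by
    intro x X
    obtain ⟨v, rfl⟩ := A.anchor_surjective x X
    -- Taking w = a*ξ in the splitting identity kills one term, as a ∘ a* = 0, and leaves ⟨s a v,
    -- a*ξ⟩ = ⟨v, a*ξ⟩. Covectors separate points.
    have key : ∀ ξ : TangentSpace 𝓘(ℝ, E) x →L[ℝ] ℝ,
        ξ (A.anchor x (s x (A.anchor x v))) = ξ (A.anchor x v) := by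
      intro ξ
      have h0 : A.anchor x (A.coanchor x ξ) = 0 := (A.exact x _).2 ⟨ξ, rfl⟩
      have h1 := hs x v (A.coanchor x ξ)
      rw [h0, map_zero, zero_apply, add_zero, ← hps, A.pairing_symm x _ (A.coanchor x ξ),
        A.pairing_symm x v (A.coanchor x ξ)] at h1
      rw [← A.two_pairing_coanchor, ← A.two_pairing_coanchor, h1]
    by_contra hne
    obtain ⟨ξ, hξ⟩ := SeparatingDual.exists_separating_of_ne (R := ℝ) (V := E) hne
    exact hξ (key ξ)
  refine ⟨⟨s, fun x => ?_, hsa, fun x X Y => ?_⟩, hps⟩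
  · exact ((A.pairing_smooth x).hom_inverse (A.isInvertible_pairing x)).2.hom_comp (hS x)
  · have h := hs x (s x X) (s x Y)
    rw [hsa, hsa, ← hps, ← hps, A.pairing_symm x (s x Y)] at h
    linarith

/-- Both sides are tested against vectors φ w, which fill the fibre. The cotangent part agrees
automatically, since a* is determined by the pairing and the anchor, both respected by φ; only the
tangent part needs `h`. -/
theorem IsotropicSplitting.preservedBy_of_pairing {A : ExtendedTangentBundle E F V}
    (s : IsotropicSplitting A) {φ : BundleAut E F V}
    (hφ : IsCourantSymmetry A.toCourantAlgebroid φ)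
    (h : ∀ (x : M) (X : TangentSpace 𝓘(ℝ, E) x) (w : V x),
      A.pairing (φ.base x) (s.toFun (φ.base x) (mfderiv 𝓘(ℝ, E) 𝓘(ℝ, E) φ.base x X))
        (φ.fibre x w) = A.pairing x (s.toFun x X) w) :
    s.PreservedBy φ := by
  intro x X η
  rw [← sub_eq_zero]
  refine A.pairing_nondegenerate _ _ fun w => ?_
  obtain ⟨w, rfl⟩ := φ.fibre_surjective x w
  have h1 := A.two_pairing_coanchor (φ.base x) η (φ.fibre x w)
  have h2 := A.two_pairing_coanchor x (η.comp (mfderiv 𝓘(ℝ, E) 𝓘(ℝ, E) φ.base x)) w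
  rw [hφ.anchor_fibre] at h1
  rw [ContinuousLinearMap.comp_apply] at h2
  simp only [map_sub, map_add, sub_apply, add_apply, hφ.pairing, h]
  linarith

end SplittingOfForm

end CourantGeometry

theorem mainTheorem4
    {E : Type*} [NormedAddCommGroup E] [NormedSpace ℝ E] [FiniteDimensional ℝ E]
    {M : Type*} [TopologicalSpace M] [ChartedSpace E M] [IsManifold 𝓘(ℝ, E) ∞ M]
    [T2Space M] [SigmaCompactSpace M]
    {F : Type*} [NormedAddCommGroup F] [NormedSpace ℝ F] [FiniteDimensional ℝ F]
    {V : M → Type*} [TopologicalSpace (TotalSpace F V)]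
    [∀ x, AddCommGroup (V x)] [∀ x, Module ℝ (V x)] [∀ x, TopologicalSpace (V x)]
    [∀ x, IsTopologicalAddGroup (V x)] [∀ x, ContinuousSMul ℝ (V x)]
    [FiberBundle F V] [VectorBundle ℝ F V] [ContMDiffVectorBundle ∞ F V 𝓘(ℝ, E)]
    {E' : Type*} [NormedAddCommGroup E'] [NormedSpace ℝ E'] [FiniteDimensional ℝ E']
    {G : Type*} [Group G] [TopologicalSpace G] [ChartedSpace E' G] [LieGroup 𝓘(ℝ, E') ∞ G]
    [T2Space G] [CompactSpace G]
    (A : CourantGeometry.ExtendedTangentBundle E F V)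
    (σ : CourantGeometry.LieGroupAction E' G A) :
    ∃ s : CourantGeometry.IsotropicSplitting A,
      ∀ g : G, s.PreservedBy (σ.hom g : CourantGeometry.BundleAut E F V) := by
  obtain ⟨R, hR, hRs⟩ := A.exists_isSplittingForm
  obtain ⟨S, hS, hSs, hinv⟩ := σ.exists_invariant_isSplittingForm hR hRs
  obtain ⟨s, hs⟩ := A.exists_isotropicSplitting_of_form hS hSs
  exact ⟨s, fun g => s.preservedBy_of_pairing (σ.isCourantSymmetry_aut g)
    fun x X w => by rw [hs, hs]; exact hinv g x X w⟩
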